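/- Let $n\ge 2$, let $\Omega\subset\mathbb{R}^n$ be a nonempty bounded open set with $C^1$ boundary (for instance a bounded $C^1$ domain; connectedness is not needed), and let $f,g\in L^\infty(\Omega)$ be real-valued with $g\ge 0$ a.e. Let $H^1_0(\Omega)$ be the completion of $C_c^\infty(\Omega)$ in the $H^1(\Omega)$-norm, let $\mathbb{K}(\Omega)=\{u\in H^1_0(\Omega): u\ge 0 \text{ a.e.}\}$, let $$\lambda^*(\Omega)=\inf_{\phi\in C_c^\infty(\Omega),\,\phi\not\equiv 0}\frac{\|\nabla\phi\|_{L^2(\Omega)}^2}{\|\phi\|_{L^2(\Omega)}^2},$$ and for $\lambda\in\mathbb{R}$ and $u\in\mathbb{K}(\Omega)$ put $$\mathcal{J}_\lambda(u)=\int_\Omega\big(|\nabla u|^2-\lambda u^2-2fu+g^2\chi_{\{u>0\}}\big)\,dx,\qquad \{u>0\}=\{x\in\Omega: u(x)>0\}\ \text{(up to null sets)}.$$ A minimizer for $\lambda$ is a $u\in\mathbb{K}(\Omega)$ with $\mathcal{J}_\lambda(u)=\inf_{\mathbb{K}(\Omega)}\mathcal{J}_\lambda$. (i) For every $\lambda<\lambda^*(\Omega)$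 there are a smallest and a largest minimizer for $\lambda$ in the pointwise a.e. sense. Consequently $$m(\lambda)=\min\{\|u\|_{L^2(\Omega)}: u \text{ is a minimizer for }\lambda\},\qquad M(\lambda)=\max\{\|u\|_{L^2(\Omega)}: u \text{ is a minimizer for }\lambda\}$$ exist, and they are the norms of the smallest and of the largest minimizer, respectively. (ii) The functions $m$ and $M$ are nondecreasing on $(-\infty,\lambda^*(\Omega))$, and they are strictly increasing on the set $\Lambda$ of all $\lambda<\lambda^*(\Omega)$ for which some minimizer is not identically zero. Moreover, for all $\lambda<\lambda^*(\Omega)$ and $\varepsilon>0$ we have $M(\lambda-\varepsilon)\le m(\lambda)$, and $$M(\lambda-\varepsilon)<m(\lambda)\quad\text{if } \lambda-\varepsilon\in\Lambda .$$ (iii) There is a countable set $Z\subset(-\infty,\lambda^*(\Omega))$ such that for every $\lambda\in(-\infty,\lambda^*(\Omega))\setminus Z$ there is exactly one minimizer for $\lambda$. -/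

import Mathlib

open Set MeasureTheory Filter Topology
open scoped ContDiff ENNReal

noncomputable section

namespace FreeBdry

/-- Euclidean space of dimension `n`. -/
abbrev E (n : ℕ) : Type := EuclideanSpace ℝ (Fin n)

/-- `Ω` has `C¹` boundary: near each boundary point, `Ω` is, for some unit vector `ν`, the region
lying strictly below (in direction `ν`) the graph of a `C¹` function `γ` over the hyperplane
orthogonal to `ν`. The vector `x - ⟪ν, x⟫ ν` is the orthogonal projection of `x` to it. -/
def HasC1Boundary {n : ℕ} (Ω : Set (E n)) : Prop :=
  ∀ x₀ ∈ frontier Ω, ∃ r > 0, ∃ ν : E n, ‖ν‖ = 1 ∧ ∃ γ : E n → ℝ, ContDiff ℝ 1 γ ∧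
    ∀ x ∈ Metric.ball x₀ r, x ∈ Ω ↔ inner ℝ ν x < γ (x - (inner ℝ ν x : ℝ) • ν)

/-- `C_c^∞(Ω)`: smooth real functions with compact support contained in `Ω`. -/
def testFunctions {n : ℕ} (Ω : Set (E n)) : Set (E n → ℝ) :=
  {φ | ContDiff ℝ ∞ φ ∧ HasCompactSupport φ ∧ tsupport φ ⊆ Ω}

/-- The fundamental tone `λ*(Ω)`, the infimum of `‖∇φ‖² / ‖φ‖²` (norms of `L²(Ω)`) over the
nonzero test functions. -/
def fundamentalTone {n : ℕ} (Ω : Set (E n)) : ℝ :=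
  sInf {q : ℝ | ∃ φ ∈ testFunctions Ω, φ ≠ 0 ∧
    q = (∫ x in Ω, ‖gradient φ x‖ ^ 2) / (∫ x in Ω, φ x ^ 2)}

/-- Pairs consisting of a function in `L²(Ω)` and a vector field in `L²(Ω; ℝⁿ)`. -/
abbrev L2Pair {n : ℕ} (Ω : Set (E n)) : Type :=
  Lp ℝ 2 (volume.restrict Ω) × Lp (E n) 2 (volume.restrict Ω)

/-- `H¹₀(Ω)`, the completion of `C_c^∞(Ω)` for the `H¹(Ω)`-norm, realized as the closure of the
pairs `(φ, ∇φ)` in `L²(Ω) × L²(Ω; ℝⁿ)`. So an element is a pair `u = (u.1, u.2)`, in which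
`u.1` is the function and `u.2` its weak gradient. -/
def H10 {n : ℕ} (Ω : Set (E n)) : Set (L2Pair Ω) :=
  closure {p : L2Pair Ω | ∃ φ ∈ testFunctions Ω,
    p.1 =ᵐ[volume.restrict Ω] φ ∧ p.2 =ᵐ[volume.restrict Ω] gradient φ}

/-- The constraint set `𝕂(Ω)`: elements of `H¹₀(Ω)` that are nonnegative almost everywhere. -/
def K {n : ℕ} (Ω : Set (E n)) : Set (L2Pair Ω) :=
  {u ∈ H10 Ω | 0 ≤ u.1}

/-- The functional
`𝒥(u) = ∫_Ω |∇u|² - λ u² - 2 f u + g² χ_{u > 0}`. -/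
def J {n : ℕ} (f g : E n → ℝ) (lam : ℝ) (Ω : Set (E n)) (u : L2Pair Ω) : ℝ :=
  ∫ x in Ω, (‖u.2 x‖ ^ 2 - lam * u.1 x ^ 2 - 2 * f x * u.1 x
    + g x ^ 2 * indicator {y | 0 < u.1 y} (fun _ => (1 : ℝ)) x)

/-- The (global) minimizers of `𝒥` in `𝕂(Ω)`. -/
def minimizers {n : ℕ} (f g : E n → ℝ) (lam : ℝ) (Ω : Set (E n)) : Set (L2Pair Ω) :=
  {u ∈ K Ω | ∀ v ∈ K Ω, J f g lam Ω u ≤ J f g lam Ω v}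

/-- The set of the `L²(Ω)`-norms of the minimizers. -/
def minimizerNorms {n : ℕ} (f g : E n → ℝ) (lam : ℝ) (Ω : Set (E n)) : Set ℝ :=
  (fun u : L2Pair Ω => ‖u.1‖) '' minimizers f g lam Ω

/-- `m(λ)`, the least `L²(Ω)`-norm of a minimizer. -/
def mNorm {n : ℕ} (f g : E n → ℝ) (Ω : Set (E n)) (lam : ℝ) : ℝ :=
  sInf (minimizerNorms f g lam Ω)

/-- `M(λ)`, the greatest `L²(Ω)`-norm of a minimizer. -/
def MNorm {n : ℕ} (f g : E n → ℝ) (Ω : Set (E n)) (lam : ℝ) : ℝ :=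
  sSup (minimizerNorms f g lam Ω)

/-- The parameters `λ < λ*(Ω)` for which some minimizer is not identically zero. -/
def nontrivialParams {n : ℕ} (f g : E n → ℝ) (Ω : Set (E n)) : Set ℝ :=
  {lam | lam < fundamentalTone Ω ∧ ∃ u ∈ minimizers f g lam Ω, u.1 ≠ 0}

end FreeBdry

end

/-! The functional is submodular on `K Ω`: the values at `u ⊓ v` and `u ⊔ v` add up to at most the
values at `u` and `v`. The quadratic, linear and positivity terms balance exactly, and the Dirichlet
energy does not increase (`exists_inf_sup_mem_K`). Hence the minimizers for one parameter form a
lattice.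

The parameter enters only through `-λ‖u‖²`. For `λ < μ` with minimizers `u`, `v`, submodularity at
`λ` gives `J_λ(u ⊔ v) ≤ J_λ(v)`, while minimality of `v` at `μ` then gives `‖u ⊔ v‖ ≤ ‖v‖`. So `u ⊔
v = v`, that is, `u ≤ v` (`fst_le_fst_of_lt`). If `u = v`, the Euler relations from scaling, at `λ`
and at `μ`, force `u = 0`. Thus `M(λ) ≤ m(μ)`, strictly when `λ` has a nontrivial minimizer. The
intervals `(m(λ), M(λ))` are therefore disjoint, and only countably many are nonempty.

Existence uses order instead of a compact embedding. For `0 ≤ a ≤ b` one has `‖b - a‖² ≤ ‖b‖² -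
‖a‖²`, so elements of almost optimal norm in a family nearly stable under infima form a Cauchy
sequence in `L²`. Gradients need only lower semicontinuity (`exists_snd_of_tendsto`), and `λ < λ*`
supplies the bounds. -/

namespace FreeBdry

/-! ### Convergence from convexity and from order in `L²` -/

section Abstract

/-- Weak lower semicontinuity of the norm of the second component on a closed convex set of pairs,
along sequences whose first components converge strongly. -/
theorem exists_snd_of_tendsto {X Y : Type*} [NormedAddCommGroup X] [NormedSpace ℝ X]
    [NormedAddCommGroup Y] [InnerProductSpace ℝ Y] [CompleteSpace Y] {H : Set (X × Y)}
    (hcl : IsClosed H) (hcv : Convex ℝ H) {u : ℕ → X × Y} (hu : ∀ k, u k ∈ H) {w : X}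
    (hw : Tendsto (fun k => (u k).1) atTop (𝓝 w)) {c : ℕ → ℝ} {c₀ : ℝ}
    (hc : Tendsto c atTop (𝓝 c₀)) (huc : ∀ k, ‖(u k).2‖ ^ 2 ≤ c k) :
    ∃ G, (w, G) ∈ H ∧ ‖G‖ ^ 2 ≤ c₀ := by
  -- the second components of the elements of `H` with first component close to `w`
  let C : ℕ → Set Y := fun m => {G | ∃ x, (x, G) ∈ H ∧ ‖x - w‖ ≤ 1 / ((m : ℝ) + 1)}
  let N : ℕ → Set ℝ := fun m => (fun G : Y => ‖G‖ ^ 2) '' C m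
  let d : ℕ → ℝ := fun m => sInf (N m)
  have hbdd : ∀ m, BddBelow (N m) := fun m => ⟨0, by rintro _ ⟨G, -, rfl⟩; positivity⟩
  have hCanti : ∀ {m k}, m ≤ k → C k ⊆ C m := by
    rintro m k hmk G ⟨x, hx, hxw⟩
    exact ⟨x, hx, hxw.trans (Nat.one_div_le_one_div hmk)⟩
  have hev : ∀ m, ∀ᶠ k in atTop, (u k).2 ∈ C m := by
    intro m
    have h1 : Tendsto (fun k => ‖(u k).1 - w‖) atTop (𝓝 0) := by
      simpa using (hw.sub_const w).norm
    filter_upwards [h1.eventually (ge_mem_nhds (show (0 : ℝ) < 1 / ((m : ℝ) + 1) by positivity))]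
      with k hk
    exact ⟨(u k).1, hu k, hk⟩
  have hCne : ∀ m, (C m).Nonempty := fun m => (hev m).exists.elim fun k hk => ⟨_, hk⟩
  have hNne : ∀ m, (N m).Nonempty := fun m => (hCne m).image _
  have hdmono : Monotone d := fun m k hmk =>
    csInf_le_csInf (hbdd m) (hNne k) (image_mono (hCanti hmk))
  have hdle : ∀ m, d m ≤ c₀ := by
    intro m
    refine ge_of_tendsto hc ?_
    filter_upwards [hev m] with k hk
    exact (csInf_le (hbdd m) ⟨_, hk, rfl⟩).trans (huc k)
  have hdconv : Tendsto d atTop (𝓝 (⨆ m, d m)) :=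
    tendsto_atTop_ciSup hdmono ⟨c₀, by rintro _ ⟨m, rfl⟩; exact hdle m⟩
  set D := ⨆ m, d m
  have hDle : ∀ m, d m ≤ D := fun m => hdmono.ge_of_tendsto hdconv m
  have hex : ∀ m : ℕ, ∃ p : X × Y, p ∈ H ∧ ‖p.1 - w‖ ≤ 1 / ((m : ℝ) + 1) ∧
      ‖p.2‖ ^ 2 < d m + 1 / ((m : ℝ) + 1) := by
    intro m
    obtain ⟨_, ⟨G, ⟨x, hx, hxw⟩, rfl⟩, hlt⟩ := exists_lt_of_csInf_lt (hNne m)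
      (show sInf (N m) < d m + 1 / ((m : ℝ) + 1) from lt_add_of_pos_right _ (by positivity))
    exact ⟨(x, G), hx, hxw, hlt⟩
  choose p hpH hpw hpd using hex
  have hone : Tendsto (fun m : ℕ => 1 / ((m : ℝ) + 1)) atTop (𝓝 0) :=
    tendsto_one_div_add_atTop_nhds_zero_nat
  have hp1 : Tendsto (fun m => (p m).1) atTop (𝓝 w) := by
    rw [tendsto_iff_norm_sub_tendsto_zero]
    exact squeeze_zero (fun _ => norm_nonneg _) hpw hone
  have hkey : ∀ m k, m ≤ k →
      ‖(p m).2 - (p k).2‖ ^ 2 ≤ 4 * (D - d m) + 4 * (1 / ((m : ℝ) + 1)) := by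
    intro m k hmk
    -- By convexity the midpoint stays in `C m`, so its squared norm is at least `d m`; the
    -- parallelogram law then makes the difference small.
    have hmem : (1 / 2 : ℝ) • (p m).2 + (1 / 2 : ℝ) • (p k).2 ∈ C m := by
      refine ⟨(1 / 2 : ℝ) • (p m).1 + (1 / 2 : ℝ) • (p k).1, ?_, ?_⟩
      · exact hcv (hpH m) (hpH k) (by norm_num) (by norm_num) (by norm_num)
      · have h2 : (1 / 2 : ℝ) • (p m).1 + (1 / 2 : ℝ) • (p k).1 - w
            = (1 / 2 : ℝ) • ((p m).1 - w) + (1 / 2 : ℝ) • ((p k).1 - w) := by module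
        have h3 := hpw m
        have h4 := (hpw k).trans (Nat.one_div_le_one_div (α := ℝ) hmk)
        rw [h2]
        refine (norm_add_le _ _).trans ?_
        rw [norm_smul, norm_smul]
        norm_num at h3 h4 ⊢
        linarith
    have h5 : d m ≤ ‖(1 / 2 : ℝ) • (p m).2 + (1 / 2 : ℝ) • (p k).2‖ ^ 2 :=
      csInf_le (hbdd m) ⟨_, hmem, rfl⟩
    rw [← smul_add, norm_smul, mul_pow] at h5
    have h6 := parallelogram_law_with_norm ℝ (p m).2 (p k).2
    have h7 := hpd m
    have h8 := hpd k
    have h9 := hDle k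
    have h10 : 1 / ((k : ℝ) + 1) ≤ 1 / ((m : ℝ) + 1) := Nat.one_div_le_one_div hmk
    have h11 := hDle m
    norm_num at h5
    linarith
  have hcau : CauchySeq fun m => (p m).2 := by
    have hb0 : Tendsto (fun m : ℕ => √(4 * (D - d m) + 4 * (1 / ((m : ℝ) + 1)))) atTop (𝓝 0) := by
      have := (((tendsto_const_nhds (x := D)).sub hdconv).const_mul 4).add (hone.const_mul 4)
      simpa using this.sqrt
    refine cauchySeq_of_le_tendsto_0' _ (fun m k hmk => ?_) hb0
    rw [dist_eq_norm]
    exact Real.le_sqrt_of_sq_le (hkey m k hmk)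
  obtain ⟨G, hG⟩ := cauchySeq_tendsto_of_complete hcau
  refine ⟨G, hcl.mem_of_tendsto (hp1.prodMk_nhds hG) (Eventually.of_forall hpH), ?_⟩
  refine le_of_tendsto_of_tendsto' (hG.norm.pow 2)
    (by simpa using (tendsto_const_nhds (x := c₀)).add hone) fun m => ?_
  exact (hpd m).le.trans (by have := hdle m; simpa using this)

variable {α : Type*} [MeasurableSpace α] {ν : Measure α}

theorem inner_nonneg_of_nonneg {a b : Lp ℝ 2 ν} (ha : 0 ≤ a) (hb : 0 ≤ b) :
    0 ≤ inner ℝ a b := by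
  rw [L2.inner_def]
  refine integral_nonneg_of_ae ?_
  filter_upwards [(Lp.coeFn_nonneg a).2 ha, (Lp.coeFn_nonneg b).2 hb] with x hx hy
  simpa using mul_nonneg hy hx

/-- Expand `‖a + (b - a)‖²`; the cross term is an integral of nonnegative functions. This turns
closeness of norms into closeness of ordered functions. -/
theorem norm_sub_sq_le_of_le {a b : Lp ℝ 2 ν} (ha : 0 ≤ a) (hab : a ≤ b) :
    ‖b - a‖ ^ 2 ≤ ‖b‖ ^ 2 - ‖a‖ ^ 2 := by
  have h := norm_add_sq_real a (b - a)
  rw [add_sub_cancel] at h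
  have := inner_nonneg_of_nonneg ha (sub_nonneg.2 hab)
  linarith

theorem eq_of_le_of_norm_le {a b : Lp ℝ 2 ν} (ha : 0 ≤ a) (hab : a ≤ b) (h : ‖b‖ ≤ ‖a‖) :
    a = b := by
  have h1 := norm_sub_sq_le_of_le ha hab
  have h2 : ‖b‖ ^ 2 ≤ ‖a‖ ^ 2 := by gcongr
  have h3 : ‖b - a‖ = 0 := by nlinarith [norm_nonneg (b - a)]
  exact (sub_eq_zero.1 (norm_eq_zero.1 h3)).symm

theorem norm_le_norm_of_nonneg_of_le {a b : Lp ℝ 2 ν} (ha : 0 ≤ a) (hab : a ≤ b) :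
    ‖a‖ ≤ ‖b‖ := by
  have h1 := norm_sub_sq_le_of_le ha hab
  nlinarith [norm_nonneg b, norm_nonneg a, sq_nonneg ‖b - a‖]

/-- In a decreasing sequence of bounded sets of nonnegative functions that is almost closed under
infima, one can choose a convergent sequence whose limit has the least possible norm. -/
theorem exists_tendsto_of_inf_mem {S : ℕ → Set (Lp ℝ 2 ν)} (hne : ∀ k, (S k).Nonempty)
    (hanti : Antitone S) (hnonneg : ∀ x ∈ S 0, 0 ≤ x) {R : ℝ} (hR : ∀ x ∈ S 0, ‖x‖ ≤ R)
    (hinf : ∀ k j, k ≤ j → ∀ x ∈ S (k + 1), ∀ y ∈ S (j + 1), x ⊓ y ∈ S k) :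
    ∃ (u : ℕ → Lp ℝ 2 ν) (w : Lp ℝ 2 ν), (∀ k, u k ∈ S k) ∧ Tendsto u atTop (𝓝 w) ∧
      ∀ v ∈ ⋂ k, S k, ‖w‖ ≤ ‖v‖ := by
  let N : ℕ → Set ℝ := fun k => (fun x : Lp ℝ 2 ν => ‖x‖ ^ 2) '' S k
  let d : ℕ → ℝ := fun k => sInf (N k)
  have hbdd : ∀ m, BddBelow (N m) := fun m => ⟨0, by rintro _ ⟨G, -, rfl⟩; positivity⟩
  have hNne : ∀ m, (N m).Nonempty := fun m => (hne m).image _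
  have hdmono : Monotone d := fun m k hmk =>
    csInf_le_csInf (hbdd m) (hNne k) (image_mono (hanti hmk))
  have hle0 : ∀ {m x}, x ∈ S m → x ∈ S 0 := fun h => hanti (Nat.zero_le _) h
  have hdle : ∀ m, d m ≤ R ^ 2 := by
    intro m
    obtain ⟨x, hx⟩ := hne m
    refine (csInf_le (hbdd m) ⟨x, hx, rfl⟩).trans ?_
    exact pow_le_pow_left₀ (norm_nonneg _) (hR x (hle0 hx)) 2
  have hdconv : Tendsto d atTop (𝓝 (⨆ m, d m)) :=
    tendsto_atTop_ciSup hdmono ⟨R ^ 2, by rintro _ ⟨m, rfl⟩; exact hdle m⟩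
  set D := ⨆ m, d m
  -- Taking an infimum costs one index, so `u m` is chosen in `S (m + 1)` to keep infima of later
  -- terms in `S m`.
  have hex : ∀ m : ℕ, ∃ x ∈ S (m + 1), ‖x‖ ^ 2 < d (m + 1) + 1 / ((m : ℝ) + 1) := by
    intro m
    obtain ⟨_, ⟨x, hx, rfl⟩, hlt⟩ := exists_lt_of_csInf_lt (hNne (m + 1))
      (show sInf (N (m + 1)) < d (m + 1) + 1 / ((m : ℝ) + 1) from
        lt_add_of_pos_right _ (by positivity))
    exact ⟨x, hx, hlt⟩
  choose u huS hud using hex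
  have hone : Tendsto (fun m : ℕ => 1 / ((m : ℝ) + 1)) atTop (𝓝 0) :=
    tendsto_one_div_add_atTop_nhds_zero_nat
  have hDle : ∀ m, d m ≤ D := fun m => hdmono.ge_of_tendsto hdconv m
  have hkey : ∀ m a b, m ≤ a → m ≤ b →
      ‖u a - u a ⊓ u b‖ ^ 2 ≤ (D - d m) + 1 / ((m : ℝ) + 1) := by
    intro m a b hma hmb
    have hmem : u a ⊓ u b ∈ S m := by
      rcases le_total a b with h | h
      · exact hanti hma (hinf a b h _ (huS a) _ (huS b))
      · rw [inf_comm]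
        exact hanti hmb (hinf b a h _ (huS b) _ (huS a))
    have h1 := norm_sub_sq_le_of_le (hnonneg _ (hle0 hmem)) (inf_le_left : u a ⊓ u b ≤ u a)
    have h2 : d m ≤ ‖u a ⊓ u b‖ ^ 2 := csInf_le (hbdd m) ⟨_, hmem, rfl⟩
    have h3 := hud a
    have h4 : 1 / ((a : ℝ) + 1) ≤ 1 / ((m : ℝ) + 1) := Nat.one_div_le_one_div hma
    have h5 := hDle (a + 1)
    linarith
  have hcau : CauchySeq u := by
    have hb0 : Tendsto (fun m : ℕ => √((D - d m) + 1 / ((m : ℝ) + 1))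
        + √((D - d m) + 1 / ((m : ℝ) + 1))) atTop (𝓝 0) := by
      have := ((tendsto_const_nhds (x := D)).sub hdconv).add hone
      simpa using this.sqrt.add this.sqrt
    refine cauchySeq_of_le_tendsto_0' _ (fun m k hmk => ?_) hb0
    -- Both terms are close to their common infimum by `hkey`.
    rw [dist_eq_norm, show u m - u k = (u m - u m ⊓ u k) - (u k - u k ⊓ u m) by
      rw [inf_comm (u k)]; abel]
    exact (norm_sub_le _ _).trans (add_le_add (Real.le_sqrt_of_sq_le (hkey m m k le_rfl hmk))
      (Real.le_sqrt_of_sq_le (hkey m k m hmk le_rfl)))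
  obtain ⟨w, hw⟩ := cauchySeq_tendsto_of_complete hcau
  refine ⟨u, w, fun k => hanti (Nat.le_succ k) (huS k), hw, fun v hv => ?_⟩
  have h1 : ‖w‖ ^ 2 ≤ ‖v‖ ^ 2 := by
    refine le_of_tendsto_of_tendsto' (hw.norm.pow 2)
      (by simpa using (tendsto_const_nhds (x := ‖v‖ ^ 2)).add hone) fun m => ?_
    have h2 : d (m + 1) ≤ ‖v‖ ^ 2 := csInf_le (hbdd _) ⟨v, mem_iInter.1 hv _, rfl⟩
    have h3 := hud m
    simp only [one_div] at *
    linarith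
  exact le_of_sq_le_sq h1 (norm_nonneg v)

/-- A nonempty bounded closed set of nonnegative functions that is closed under suprema has a
largest element. -/
theorem exists_greatest_of_sup_mem {S : Set (Lp ℝ 2 ν)} (hne : S.Nonempty) (hcl : IsClosed S)
    (hnonneg : ∀ x ∈ S, 0 ≤ x) {R : ℝ} (hR : ∀ x ∈ S, ‖x‖ ≤ R)
    (hsup : ∀ x ∈ S, ∀ y ∈ S, x ⊔ y ∈ S) : ∃ w, IsGreatest S w := by
  let N : Set ℝ := (fun x : Lp ℝ 2 ν => ‖x‖ ^ 2) '' S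
  have hbdd : BddAbove N := ⟨R ^ 2, by
    rintro _ ⟨x, hx, rfl⟩
    exact pow_le_pow_left₀ (norm_nonneg _) (hR x hx) 2⟩
  have hNne : N.Nonempty := hne.image _
  set D := sSup N
  have hex : ∀ m : ℕ, ∃ x ∈ S, D - 1 / ((m : ℝ) + 1) < ‖x‖ ^ 2 := by
    intro m
    obtain ⟨_, ⟨x, hx, rfl⟩, hlt⟩ := exists_lt_of_lt_csSup hNne
      (show D - 1 / ((m : ℝ) + 1) < sSup N from sub_lt_self _ (by positivity))
    exact ⟨x, hx, hlt⟩
  choose u huS hud using hex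
  have hone : Tendsto (fun m : ℕ => 1 / ((m : ℝ) + 1)) atTop (𝓝 0) :=
    tendsto_one_div_add_atTop_nhds_zero_nat
  have hkey : ∀ x ∈ S, ∀ y ∈ S, ‖y ⊔ x - x‖ ^ 2 ≤ D - ‖x‖ ^ 2 := by
    intro x hx y hy
    have h1 := norm_sub_sq_le_of_le (hnonneg x hx) (le_sup_right : x ≤ y ⊔ x)
    have h2 : ‖y ⊔ x‖ ^ 2 ≤ D := le_csSup hbdd ⟨_, hsup y hy x hx, rfl⟩
    linarith
  have hcau : CauchySeq u := by
    have hb0 : Tendsto (fun m : ℕ => √(1 / ((m : ℝ) + 1)) + √(1 / ((m : ℝ) + 1)))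
        atTop (𝓝 0) := by
      simpa using hone.sqrt.add hone.sqrt
    refine cauchySeq_of_le_tendsto_0' _ (fun m k hmk => ?_) hb0
    have h4 : 1 / ((k : ℝ) + 1) ≤ 1 / ((m : ℝ) + 1) := Nat.one_div_le_one_div hmk
    rw [dist_eq_norm, show u m - u k = (u m ⊔ u k - u k) - (u k ⊔ u m - u m) by
      rw [sup_comm (u k)]; abel]
    refine (norm_sub_le _ _).trans (add_le_add (Real.le_sqrt_of_sq_le ?_)
      (Real.le_sqrt_of_sq_le ?_))
    · have := hkey _ (huS k) _ (huS m)
      have := hud k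
      linarith
    · have := hkey _ (huS m) _ (huS k)
      have := hud m
      linarith
  obtain ⟨w, hw⟩ := cauchySeq_tendsto_of_complete hcau
  have hwS : w ∈ S := hcl.mem_of_tendsto hw (Eventually.of_forall huS)
  have hwD : D ≤ ‖w‖ ^ 2 := by
    refine le_of_tendsto_of_tendsto' (by simpa using (tendsto_const_nhds (x := D)).sub hone)
      (hw.norm.pow 2) fun m => ?_
    simpa using (hud m).le
  refine ⟨w, hwS, fun v hv => ?_⟩
  have h1 := hkey w hwS v hv
  have h2 : ‖v ⊔ w - w‖ = 0 := by nlinarith [norm_nonneg (v ⊔ w - w)]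
  have h3 : v ⊔ w = w := sub_eq_zero.1 (norm_eq_zero.1 h2)
  exact h3 ▸ le_sup_left

end Abstract

/-! ### Lattice structure and Poincaré inequality in `H¹₀(Ω)` -/

section Space

variable {n : ℕ} {Ω : Set (E n)}

theorem hasGradientAt_of_mem_testFunctions {φ : E n → ℝ} (hφ : φ ∈ testFunctions Ω) (x : E n) :
    HasGradientAt φ (gradient φ x) x :=
  (hφ.1.differentiable (by simp) x).hasGradientAt

theorem hasGradientAt_comp {F : Type*} [NormedAddCommGroup F]
    [InnerProductSpace ℝ F] [CompleteSpace F] {φ : F → ℝ} {φ' x : F} {b : ℝ → ℝ} {b' : ℝ}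
    (hb : HasDerivAt b b' (φ x)) (hφ : HasGradientAt φ φ' x) :
    HasGradientAt (fun y => b (φ y)) (b' • φ') x := by
  rw [hasGradientAt_iff_hasFDerivAt] at *
  simpa [Function.comp_def] using hb.comp_hasFDerivAt x hφ

theorem hasGradientAt_add {F : Type*} [NormedAddCommGroup F]
    [InnerProductSpace ℝ F] [CompleteSpace F] {φ ψ : F → ℝ} {φ' ψ' x : F}
    (hφ : HasGradientAt φ φ' x) (hψ : HasGradientAt ψ ψ' x) :
    HasGradientAt (φ + ψ) (φ' + ψ') x := by
  rw [hasGradientAt_iff_hasFDerivAt] at *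
  simpa using hφ.add hψ

theorem comp_mem_testFunctions {φ : E n → ℝ} (hφ : φ ∈ testFunctions Ω) {b : ℝ → ℝ}
    (hb : ContDiff ℝ ∞ b) (hb0 : b 0 = 0) : (fun x => b (φ x)) ∈ testFunctions Ω :=
  ⟨hb.comp hφ.1, hφ.2.1.comp_left hb0, (tsupport_comp_subset hb0 φ).trans hφ.2.2⟩

theorem add_mem_testFunctions {φ ψ : E n → ℝ} (hφ : φ ∈ testFunctions Ω)
    (hψ : ψ ∈ testFunctions Ω) : φ + ψ ∈ testFunctions Ω :=
  ⟨hφ.1.add hψ.1, hφ.2.1.add hψ.2.1,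
    (tsupport_add φ ψ).trans (union_subset hφ.2.2 hψ.2.2)⟩

variable (Ω) in
/-- The pairs `(φ, ∇φ)` with `φ ∈ C_c^∞(Ω)`. -/
noncomputable def testPairs : Submodule ℝ (L2Pair Ω) where
  carrier := {p : L2Pair Ω | ∃ φ ∈ testFunctions Ω,
    p.1 =ᵐ[volume.restrict Ω] φ ∧ p.2 =ᵐ[volume.restrict Ω] gradient φ}
  zero_mem' := by
    refine ⟨0, ⟨contDiff_const, HasCompactSupport.zero, by simp [tsupport]⟩,
      Lp.coeFn_zero _ _ _, ?_⟩
    filter_upwards [Lp.coeFn_zero (E n) 2 (volume.restrict Ω)] with x hx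
    exact hx.trans (hasGradientAt_const x (0 : ℝ)).gradient.symm
  add_mem' := by
    rintro p q ⟨φ, hφ, hp1, hp2⟩ ⟨ψ, hψ, hq1, hq2⟩
    refine ⟨φ + ψ, add_mem_testFunctions hφ hψ, (Lp.coeFn_add _ _).trans (hp1.add hq1), ?_⟩
    filter_upwards [Lp.coeFn_add p.2 q.2, hp2, hq2] with x h1 h2 h3
    rw [(hasGradientAt_add (hasGradientAt_of_mem_testFunctions hφ x)
      (hasGradientAt_of_mem_testFunctions hψ x)).gradient, ← h2, ← h3]
    exact h1
  smul_mem' := by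
    rintro c p ⟨φ, hφ, hp1, hp2⟩
    refine ⟨fun x => c * φ x, comp_mem_testFunctions hφ (b := fun t => c * t)
      (contDiff_const.mul contDiff_id) (mul_zero c), ?_, ?_⟩
    · filter_upwards [Lp.coeFn_smul c p.1, hp1] with x h1 h2
      rw [← h2]
      exact h1
    · filter_upwards [Lp.coeFn_smul c p.2, hp2] with x h1 h2
      have hd : HasDerivAt (fun t : ℝ => c * t) c (φ x) := by
        simpa using (hasDerivAt_id (φ x)).const_mul c
      rw [(hasGradientAt_comp hd (hasGradientAt_of_mem_testFunctions hφ x)).gradient, ← h2]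
      exact h1

theorem isClosed_H10 : IsClosed (H10 Ω) := isClosed_closure

theorem zero_mem_H10 : (0 : L2Pair Ω) ∈ H10 Ω := (testPairs Ω).topologicalClosure.zero_mem

theorem add_mem_H10 {p q : L2Pair Ω} (hp : p ∈ H10 Ω) (hq : q ∈ H10 Ω) : p + q ∈ H10 Ω :=
  (testPairs Ω).topologicalClosure.add_mem hp hq

theorem sub_mem_H10 {p q : L2Pair Ω} (hp : p ∈ H10 Ω) (hq : q ∈ H10 Ω) : p - q ∈ H10 Ω :=
  (testPairs Ω).topologicalClosure.sub_mem hp hq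

theorem smul_mem_H10 (c : ℝ) {p : L2Pair Ω} (hp : p ∈ H10 Ω) : c • p ∈ H10 Ω :=
  (testPairs Ω).topologicalClosure.smul_mem c hp

theorem convex_H10 : Convex ℝ (H10 Ω) := (testPairs Ω).topologicalClosure.convex

theorem norm_sq_eq_integral {α F : Type*} [MeasurableSpace α] {ν : Measure α}
    [NormedAddCommGroup F] [InnerProductSpace ℝ F] (x : Lp F 2 ν) :
    ‖x‖ ^ 2 = ∫ a, ‖x a‖ ^ 2 ∂ν := by
  rw [← real_inner_self_eq_norm_sq, L2.inner_def]
  simp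

/-- The Poincaré inequality in `H¹₀(Ω)` with the fundamental tone as constant. -/
theorem fundamentalTone_mul_le {p : L2Pair Ω} (hp : p ∈ H10 Ω) :
    fundamentalTone Ω * ‖p.1‖ ^ 2 ≤ ‖p.2‖ ^ 2 := by
  have hcl : IsClosed {p : L2Pair Ω | fundamentalTone Ω * ‖p.1‖ ^ 2 ≤ ‖p.2‖ ^ 2} :=
    isClosed_le (by fun_prop) (by fun_prop)
  refine closure_minimal ?_ hcl hp
  rintro p ⟨φ, hφ, h1, h2⟩
  have e1 : ‖p.1‖ ^ 2 = ∫ x in Ω, φ x ^ 2 := by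
    rw [norm_sq_eq_integral]
    refine integral_congr_ae ?_
    filter_upwards [h1] with x hx
    rw [hx, Real.norm_eq_abs, sq_abs]
  have e2 : ‖p.2‖ ^ 2 = ∫ x in Ω, ‖gradient φ x‖ ^ 2 := by
    rw [norm_sq_eq_integral]
    refine integral_congr_ae ?_
    filter_upwards [h2] with x hx
    rw [hx]
  rcases eq_or_ne (‖p.1‖ ^ 2) 0 with h0 | h0
  · simp only [mem_ofPred_eq, h0, mul_zero]
    positivity
  · have hpos : 0 < ‖p.1‖ ^ 2 := lt_of_le_of_ne (by positivity) h0.symm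
    have hφ0 : φ ≠ 0 := by
      rintro rfl
      exact h0 (by simp [e1])
    refine (le_div_iff₀ hpos).1 (csInf_le ⟨0, ?_⟩ ⟨φ, hφ, hφ0, by rw [e1, e2]⟩)
    rintro q ⟨φ, -, -, rfl⟩
    exact div_nonneg (integral_nonneg fun _ => by positivity)
      (integral_nonneg fun _ => by positivity)

/-- A smooth approximation of the absolute value. -/
noncomputable def smoothAbs (ε t : ℝ) : ℝ := √(t ^ 2 + ε ^ 2) - ε

/-- Vanishing at the origin keeps the support of a composition inside `Ω`. -/
theorem smoothAbs_zero {ε : ℝ} (hε : 0 < ε) : smoothAbs ε 0 = 0 := by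
  simp [smoothAbs, hε.le]

theorem contDiff_smoothAbs {ε : ℝ} (hε : 0 < ε) : ContDiff ℝ ∞ (smoothAbs ε) := by
  unfold smoothAbs
  refine ContDiff.sub (ContDiff.sqrt (by fun_prop) fun t => ?_) contDiff_const
  positivity

theorem hasDerivAt_smoothAbs {ε : ℝ} (hε : 0 < ε) (t : ℝ) :
    HasDerivAt (smoothAbs ε) (t / √(t ^ 2 + ε ^ 2)) t := by
  have h : HasDerivAt (fun t : ℝ => t ^ 2 + ε ^ 2) (2 * t) t := by
    simpa using (hasDerivAt_pow 2 t).add_const (ε ^ 2)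
  refine ((h.sqrt (by positivity)).sub_const ε).congr_deriv ?_
  field_simp

/-- This bounds the derivative of `smoothAbs`, so composition does not increase the length of the
gradient. -/
theorem abs_div_sqrt_le_one (ε t : ℝ) : |t / √(t ^ 2 + ε ^ 2)| ≤ 1 := by
  rw [abs_div, abs_of_nonneg (Real.sqrt_nonneg _)]
  refine div_le_one_of_le₀ ?_ (Real.sqrt_nonneg _)
  exact Real.abs_le_sqrt (by nlinarith [sq_nonneg ε])

theorem abs_smoothAbs_sub_abs_le {ε : ℝ} (hε : 0 < ε) (t : ℝ) : |(smoothAbs ε t - |t|)| ≤ ε := by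
  have h1 : |t| ≤ √(t ^ 2 + ε ^ 2) := Real.abs_le_sqrt (by nlinarith [sq_nonneg ε])
  have h2 : √(t ^ 2 + ε ^ 2) ≤ |t| + ε := by
    refine Real.sqrt_le_left (by positivity) |>.2 ?_
    nlinarith [abs_nonneg t, sq_abs t]
  rw [abs_le, smoothAbs]
  constructor <;> linarith

/-- `H¹₀(Ω)` is closed under absolute values, and these do not increase the Dirichlet energy. -/
theorem exists_abs_mem_H10 [IsFiniteMeasure (volume.restrict Ω)] {p : L2Pair Ω}
    (hp : p ∈ H10 Ω) : ∃ G, ((|p.1|, G) : L2Pair Ω) ∈ H10 Ω ∧ ‖G‖ ^ 2 ≤ ‖p.2‖ ^ 2 := by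
  obtain ⟨q, hq, hqp⟩ := mem_closure_iff_seq_limit.1 hp
  set e : ℕ → ℝ := fun k => 1 / ((k : ℝ) + 1) with he
  have hepos : ∀ k, 0 < e k := fun k => by simp only [he]; positivity
  have he0 : Tendsto e atTop (𝓝 0) := tendsto_one_div_add_atTop_nhds_zero_nat
  -- The factor `|Ω|^(1/2)` by which a uniform bound controls the `L²` norm.
  set B : ℝ := measureUnivNNReal (volume.restrict Ω) ^ (2 : ℝ≥0∞).toReal⁻¹
  have hex : ∀ k, ∃ r : L2Pair Ω, r ∈ H10 Ω ∧ ‖r.1 - |(q k).1|‖ ≤ B * e k ∧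
      ‖r.2‖ ≤ ‖(q k).2‖ := by
    intro k
    obtain ⟨φ, hφ, h1, h2⟩ := hq k
    set ψ : E n → ℝ := fun x => smoothAbs (e k) (φ x)
    have hψ : ψ ∈ testFunctions Ω :=
      comp_mem_testFunctions hφ (contDiff_smoothAbs (hepos k)) (smoothAbs_zero (hepos k))
    have hgrad : ∀ x, gradient ψ x = (φ x / √(φ x ^ 2 + e k ^ 2)) • gradient φ x := fun x =>
      (hasGradientAt_comp (hasDerivAt_smoothAbs (hepos k) (φ x))
        (hasGradientAt_of_mem_testFunctions hφ x)).gradient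
    have hcg : Continuous (gradient ψ) := by
      have h : Continuous (fderiv ℝ ψ) := hψ.1.continuous_fderiv (by simp)
      exact (InnerProductSpace.toDual ℝ (E n)).symm.continuous.comp h
    have hnorm : ∀ x, ‖gradient ψ x‖ ≤ ‖gradient φ x‖ := by
      intro x
      rw [hgrad, norm_smul, Real.norm_eq_abs]
      exact mul_le_of_le_one_left (norm_nonneg _) (abs_div_sqrt_le_one _ _)
    have hm1 : MemLp ψ 2 (volume.restrict Ω) :=
      hψ.1.continuous.memLp_of_hasCompactSupport hψ.2.1
    have hm2 : MemLp (gradient ψ) 2 (volume.restrict Ω) := by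
      refine (Lp.memLp (q k).2).of_le hcg.aestronglyMeasurable ?_
      filter_upwards [h2] with x hx
      rw [hx]
      exact hnorm x
    refine ⟨(hm1.toLp ψ, hm2.toLp _),
      subset_closure ⟨ψ, hψ, hm1.coeFn_toLp, hm2.coeFn_toLp⟩, ?_, ?_⟩
    · refine Lp.norm_le_of_ae_bound (hepos k).le ?_
      filter_upwards [Lp.coeFn_sub (hm1.toLp ψ) |(q k).1|, hm1.coeFn_toLp,
        Lp.coeFn_abs (q k).1, h1] with x a1 a2 a3 a4
      rw [a1, Pi.sub_apply, a2, a3, a4]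
      exact abs_smoothAbs_sub_abs_le (hepos k) _
    · refine Lp.norm_le_norm_of_ae_le ?_
      filter_upwards [hm2.coeFn_toLp, h2] with x a1 a2
      rw [a1, a2]
      exact hnorm x
  choose r hr hr1 hr2 using hex
  have hq1 : Tendsto (fun k => |(q k).1|) atTop (𝓝 |p.1|) :=
    ((continuous_id.sup continuous_neg).tendsto p.1).comp ((continuous_fst.tendsto p).comp hqp)
  have hd : Tendsto (fun k => (r k).1 - |(q k).1|) atTop (𝓝 0) :=
    squeeze_zero_norm hr1 (by simpa using he0.const_mul B)
  -- Only the functions converge strongly; lower semicontinuity supplies some gradient `G` without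
  -- identifying it.
  refine exists_snd_of_tendsto isClosed_H10 convex_H10 hr (by simpa using hd.add hq1)
    (((continuous_snd.tendsto p).comp hqp).norm.pow 2)
    fun k => pow_le_pow_left₀ (norm_nonneg _) (hr2 k) 2

/-- Lattice operations in `H¹₀(Ω)`, with the submodularity of the Dirichlet energy. -/
theorem exists_inf_sup_mem_H10 [IsFiniteMeasure (volume.restrict Ω)] {p q : L2Pair Ω}
    (hp : p ∈ H10 Ω) (hq : q ∈ H10 Ω) :
    ∃ G₁ G₂, ((p.1 ⊓ q.1, G₁) : L2Pair Ω) ∈ H10 Ω ∧ ((p.1 ⊔ q.1, G₂) : L2Pair Ω) ∈ H10 Ω ∧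
      ‖G₁‖ ^ 2 + ‖G₂‖ ^ 2 ≤ ‖p.2‖ ^ 2 + ‖q.2‖ ^ 2 := by
  obtain ⟨G, hG, hGn⟩ := exists_abs_mem_H10 (sub_mem_H10 hq hp)
  -- These mirror `(p + q ∓ |q - p|) / 2`. The parallelogram law, applied twice, together with the
  -- bound on `G` gives the energy inequality.
  refine ⟨(2⁻¹ : ℝ) • (p.2 + q.2 - G), (2⁻¹ : ℝ) • (p.2 + q.2 + G), ?_, ?_, ?_⟩
  · convert smul_mem_H10 (2⁻¹ : ℝ) (sub_mem_H10 (add_mem_H10 hp hq) hG) using 1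
    rw [inf_eq_half_smul_add_sub_abs_sub' ℝ]
    rfl
  · convert smul_mem_H10 (2⁻¹ : ℝ) (add_mem_H10 (add_mem_H10 hp hq) hG) using 1
    rw [sup_eq_half_smul_add_add_abs_sub' ℝ]
    rfl
  · rw [norm_smul, norm_smul, mul_pow, mul_pow]
    have h1 := parallelogram_law_with_norm ℝ (p.2 + q.2) G
    have h2 := parallelogram_law_with_norm ℝ q.2 p.2
    rw [add_comm q.2] at h2
    simp only [Prod.snd_sub] at hGn
    norm_num
    linarith

theorem isClosed_K : IsClosed (K Ω) :=
  isClosed_H10.inter ((isClosed_Ici (a := (0 : Lp ℝ 2 (volume.restrict Ω)))).preimage continuous_fst)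

theorem convex_K : Convex ℝ (K Ω) := by
  intro p hp q hq a b ha hb hab
  refine ⟨convex_H10 hp.1 hq.1 ha hb hab, ?_⟩
  rw [← Lp.coeFn_nonneg]
  filter_upwards [(Lp.coeFn_nonneg _).2 hp.2, (Lp.coeFn_nonneg _).2 hq.2,
    Lp.coeFn_add (a • p.1) (b • q.1), Lp.coeFn_smul a p.1, Lp.coeFn_smul b q.1]
    with x h1 h2 h3 h4 h5
  simp only [Pi.zero_apply, Pi.add_apply, Pi.smul_apply, smul_eq_mul] at *
  refine le_of_le_of_eq ?_ h3.symm
  rw [h4, h5]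
  positivity

theorem zero_mem_K : (0 : L2Pair Ω) ∈ K Ω := ⟨zero_mem_H10, le_rfl⟩

theorem smul_mem_K {c : ℝ} (hc : 0 ≤ c) {p : L2Pair Ω} (hp : p ∈ K Ω) : c • p ∈ K Ω := by
  refine ⟨smul_mem_H10 c hp.1, ?_⟩
  rw [← Lp.coeFn_nonneg]
  filter_upwards [(Lp.coeFn_nonneg _).2 hp.2, Lp.coeFn_smul c p.1] with x h1 h2
  simp only [Pi.zero_apply, Pi.smul_apply, smul_eq_mul] at *
  exact le_of_le_of_eq (mul_nonneg hc h1) h2.symm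

end Space

/-! ### The energy of the positivity set -/

section PositivityEnergy

variable {α : Type*} [MeasurableSpace α] {ν : Measure α} {g : α → ℝ}

/-- The energy `∫ g² χ_{u > 0}` of the positivity set of `u`. -/
noncomputable def posEnergy (ν : Measure α) (g u : α → ℝ) : ℝ :=
  ∫ x, g x ^ 2 * indicator {y | 0 < u y} (fun _ => (1 : ℝ)) x ∂ν

theorem integrable_posEnergy (hg : MemLp g 2 ν) (u : Lp ℝ 2 ν) :
    Integrable (fun x => g x ^ 2 * indicator {y | 0 < u y} (fun _ => (1 : ℝ)) x) ν := by
  have hs : MeasurableSet {y | 0 < u y} :=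
    measurableSet_lt measurable_const (Lp.stronglyMeasurable u).measurable
  refine (hg.integrable_sq.indicator hs).congr (Eventually.of_forall fun x => ?_)
  by_cases hx : 0 < u x <;> simp [indicator, hx]

theorem posEnergy_nonneg (u : α → ℝ) : 0 ≤ posEnergy ν g u :=
  integral_nonneg fun x => mul_nonneg (sq_nonneg _) (indicator_nonneg (fun _ _ => zero_le_one) x)

theorem posEnergy_inf_add_sup (hg : MemLp g 2 ν) (u v : Lp ℝ 2 ν) :
    posEnergy ν g (u ⊓ v : Lp ℝ 2 ν) + posEnergy ν g (u ⊔ v : Lp ℝ 2 ν)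
      = posEnergy ν g u + posEnergy ν g v := by
  unfold posEnergy
  rw [← integral_add (integrable_posEnergy hg _) (integrable_posEnergy hg _),
    ← integral_add (integrable_posEnergy hg _) (integrable_posEnergy hg _)]
  refine integral_congr_ae ?_
  filter_upwards [Lp.coeFn_inf u v, Lp.coeFn_sup u v] with x h1 h2
  have e1 : (0 < (u ⊓ v : Lp ℝ 2 ν) x) ↔ (0 < u x ∧ 0 < v x) := by rw [h1]; exact lt_min_iff
  have e2 : (0 < (u ⊔ v : Lp ℝ 2 ν) x) ↔ (0 < u x ∨ 0 < v x) := by rw [h2]; exact lt_max_iff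
  by_cases a : 0 < u x <;> by_cases b : 0 < v x <;> simp [indicator, e1, e2, a, b]

theorem posEnergy_smul {t : ℝ} (ht : 0 < t) (u : Lp ℝ 2 ν) :
    posEnergy ν g (t • u : Lp ℝ 2 ν) = posEnergy ν g u := by
  refine integral_congr_ae ?_
  filter_upwards [Lp.coeFn_smul t u] with x h
  have e : (0 < (t • u : Lp ℝ 2 ν) x) ↔ 0 < u x := by
    rw [h, Pi.smul_apply, smul_eq_mul, mul_pos_iff_of_pos_left ht]
  simp [indicator, e]

/-- Along a subsequence, the energy of the positivity set is bounded below by a sequence converging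
to the energy of the limit. -/
theorem exists_subseq_posEnergy (hg : MemLp g 2 ν) {u : ℕ → Lp ℝ 2 ν} {w : Lp ℝ 2 ν}
    (hu : Tendsto u atTop (𝓝 w)) :
    ∃ s : ℕ → ℕ, StrictMono s ∧ ∃ c : ℕ → ℝ, Tendsto c atTop (𝓝 (posEnergy ν g w)) ∧
      ∀ k, c k ≤ posEnergy ν g (u (s k)) := by
  obtain ⟨s, hs, hae⟩ := (tendstoInMeasure_of_tendsto_Lp hu).exists_seq_tendsto_ae
  -- The bound uses the intersection of the positivity sets of `u (s k)` and `w`: at almost every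
  -- point its indicator is eventually that of `{w > 0}`, so dominated convergence applies.
  refine ⟨s, hs, fun k => ∫ x, g x ^ 2 * indicator {y | 0 < (u (s k) ⊓ w : Lp ℝ 2 ν) y}
    (fun _ => (1 : ℝ)) x ∂ν, ?_, fun k => ?_⟩
  · refine tendsto_integral_of_dominated_convergence (fun x => g x ^ 2)
      (fun k => (integrable_posEnergy hg _).aestronglyMeasurable) hg.integrable_sq
      (fun k => Eventually.of_forall fun x => ?_) ?_
    · rw [norm_mul, Real.norm_of_nonneg (sq_nonneg _)]
      refine mul_le_of_le_one_right (sq_nonneg _) ?_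
      by_cases hx : 0 < (u (s k) ⊓ w : Lp ℝ 2 ν) x <;> simp [indicator, hx]
    · filter_upwards [hae, ae_all_iff.2 fun k => Lp.coeFn_inf (u (s k)) w] with x h1 h2
      refine tendsto_const_nhds.congr' ?_
      have e : ∀ k, (0 < (u (s k) ⊓ w : Lp ℝ 2 ν) x) ↔ (0 < u (s k) x ∧ 0 < w x) := by
        intro k; rw [h2]; exact lt_min_iff
      by_cases hx : 0 < w x
      · filter_upwards [h1.eventually (lt_mem_nhds hx)] with k hk
        simp [indicator, e, hk, hx]
      · exact Eventually.of_forall fun k => by simp [indicator, e, hx]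
  · refine integral_mono_ae (integrable_posEnergy hg _) (integrable_posEnergy hg _) ?_
    filter_upwards [Lp.coeFn_inf (u (s k)) w] with x h
    have e : (0 < (u (s k) ⊓ w : Lp ℝ 2 ν) x) ↔ (0 < u (s k) x ∧ 0 < w x) := by
      rw [h]; exact lt_min_iff
    by_cases a : 0 < u (s k) x <;> by_cases b : 0 < w x <;>
      simp [indicator, e, a, b, sq_nonneg]

/-- The supremum and infimum have the same sum as `u` and `v`, and their difference is `|v - u|`;
apply the parallelogram law to both pairs. -/
theorem norm_inf_sq_add_norm_sup_sq (u v : Lp ℝ 2 ν) :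
    ‖u ⊓ v‖ ^ 2 + ‖u ⊔ v‖ ^ 2 = ‖u‖ ^ 2 + ‖v‖ ^ 2 := by
  have e1 := norm_sub_sq_real (u ⊔ v) (u ⊓ v)
  have e2 := norm_add_sq_real (u ⊔ v) (u ⊓ v)
  have e3 := norm_sub_sq_real v u
  have e4 := norm_add_sq_real v u
  rw [sup_sub_inf_eq_abs_sub, norm_abs_eq_norm] at e1
  rw [add_comm, inf_add_sup, add_comm] at e2
  linarith

end PositivityEnergy

/-! ### Existence, order and uniqueness of minimizers -/

section Functional

variable {n : ℕ} {Ω : Set (E n)} {f g : E n → ℝ}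

theorem J_eq (hf : MemLp f 2 (volume.restrict Ω)) (hg : MemLp g 2 (volume.restrict Ω)) (lam : ℝ)
    (u : L2Pair Ω) : J f g lam Ω u = ‖u.2‖ ^ 2 - lam * ‖u.1‖ ^ 2 - 2 * inner ℝ (hf.toLp f) u.1
      + posEnergy (volume.restrict Ω) g u.1 := by
  have i1 : Integrable (fun x => ‖u.2 x‖ ^ 2) (volume.restrict Ω) :=
    (Lp.memLp u.2).integrable_norm_pow two_ne_zero
  have i2 : Integrable (fun x => lam * u.1 x ^ 2) (volume.restrict Ω) :=
    (Lp.memLp u.1).integrable_sq.const_mul lam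
  have i3 : Integrable (fun x => 2 * f x * u.1 x) (volume.restrict Ω) := by
    simpa [mul_assoc] using (hf.integrable_mul (Lp.memLp u.1)).const_mul 2
  have e2 : ‖u.1‖ ^ 2 = ∫ x in Ω, u.1 x ^ 2 := by
    rw [norm_sq_eq_integral]
    simp
  have e3 : 2 * inner ℝ (hf.toLp f) u.1 = ∫ x in Ω, 2 * f x * u.1 x := by
    rw [L2.inner_def, ← integral_const_mul]
    refine integral_congr_ae ?_
    filter_upwards [hf.coeFn_toLp] with x hx
    simp only [hx, RCLike.inner_apply, conj_trivial]
    ring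
  have i12 : Integrable (fun x => ‖u.2 x‖ ^ 2 - lam * u.1 x ^ 2) (volume.restrict Ω) := i1.sub i2
  have i123 : Integrable (fun x => ‖u.2 x‖ ^ 2 - lam * u.1 x ^ 2 - 2 * f x * u.1 x)
    (volume.restrict Ω) := i12.sub i3
  rw [J, integral_add i123 (integrable_posEnergy hg u.1), integral_sub i12 i3, integral_sub i1 i2, integral_const_mul, norm_sq_eq_integral u.2,
    e2, e3]
  rfl

theorem J_eq_add (hf : MemLp f 2 (volume.restrict Ω)) (hg : MemLp g 2 (volume.restrict Ω))
    (lam mu : ℝ) (u : L2Pair Ω) : J f g lam Ω u = J f g mu Ω u + (mu - lam) * ‖u.1‖ ^ 2 := by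
  rw [J_eq hf hg, J_eq hf hg]
  ring

/-- Submodularity of the functional on `𝕂(Ω)`. -/
theorem exists_inf_sup_mem_K [IsFiniteMeasure (volume.restrict Ω)]
    (hf : MemLp f 2 (volume.restrict Ω))
    (hg : MemLp g 2 (volume.restrict Ω)) (lam : ℝ) {u v : L2Pair Ω} (hu : u ∈ K Ω) (hv : v ∈ K Ω) :
    ∃ a ∈ K Ω, ∃ b ∈ K Ω, a.1 = u.1 ⊓ v.1 ∧ b.1 = u.1 ⊔ v.1 ∧
      J f g lam Ω a + J f g lam Ω b ≤ J f g lam Ω u + J f g lam Ω v := by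
  obtain ⟨G₁, G₂, h1, h2, h3⟩ := exists_inf_sup_mem_H10 hu.1 hv.1
  refine ⟨(u.1 ⊓ v.1, G₁), ⟨h1, le_inf hu.2 hv.2⟩, (u.1 ⊔ v.1, G₂),
    ⟨h2, le_sup_of_le_left hu.2⟩, rfl, rfl, ?_⟩
  simp only [J_eq hf hg]
  have e1 := posEnergy_inf_add_sup hg u.1 v.1
  have e2 := norm_inf_sq_add_norm_sup_sq u.1 v.1
  have e3 : inner ℝ (hf.toLp f) (u.1 ⊓ v.1) + inner ℝ (hf.toLp f) (u.1 ⊔ v.1)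
      = inner ℝ (hf.toLp f) u.1 + inner ℝ (hf.toLp f) v.1 := by
    rw [← inner_add_right, inf_add_sup, inner_add_right]
  have e4 : lam * ‖u.1 ⊓ v.1‖ ^ 2 + lam * ‖u.1 ⊔ v.1‖ ^ 2 = lam * ‖u.1‖ ^ 2 + lam * ‖v.1‖ ^ 2 := by
    rw [← mul_add, e2, mul_add]
  linarith

/-- Lower semicontinuity of the functional under `L²`-convergence. -/
theorem exists_mem_K_of_tendsto (hf : MemLp f 2 (volume.restrict Ω))
    (hg : MemLp g 2 (volume.restrict Ω)) (lam : ℝ) {u : ℕ → L2Pair Ω} (hu : ∀ k, u k ∈ K Ω)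
    {w : Lp ℝ 2 (volume.restrict Ω)} (hw : Tendsto (fun k => (u k).1) atTop (𝓝 w))
    {c : ℕ → ℝ} {c₀ : ℝ} (hc : Tendsto c atTop (𝓝 c₀)) (huc : ∀ k, J f g lam Ω (u k) ≤ c k) :
    ∃ G, ((w, G) : L2Pair Ω) ∈ K Ω ∧ J f g lam Ω (w, G) ≤ c₀ := by
  obtain ⟨s, hs, d, hd, hds⟩ := exists_subseq_posEnergy hg hw
  have hw' := hw.comp hs.tendsto_atTop
  -- The gradient bound comes from solving `J ≤ c` for the Dirichlet term, with the positivity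
  -- energy replaced by its convergent lower bound `d`.
  obtain ⟨G, hG, hGn⟩ := exists_snd_of_tendsto isClosed_K convex_K (fun k => hu (s k)) hw'
    ((((hc.comp hs.tendsto_atTop).add ((hw'.norm.pow 2).const_mul lam)).add
      ((hw'.inner (𝕜 := ℝ) (tendsto_const_nhds (x := hf.toLp f))).const_mul 2)).sub hd) (by
      intro k
      have h1 := huc (s k)
      have h2 := hds k
      rw [J_eq hf hg] at h1
      simp only [Function.comp_apply]
      rw [real_inner_comm]
      linarith)
  refine ⟨G, hG, ?_⟩
  rw [J_eq hf hg]
  rw [real_inner_comm] at hGn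
  simp only
  linarith

/-- The Poincaré inequality absorbs the `λ` term, Cauchy–Schwarz controls the `f` term, and the
positivity energy is dropped. -/
theorem coercive (hf : MemLp f 2 (volume.restrict Ω)) (hg : MemLp g 2 (volume.restrict Ω))
    (lam : ℝ) {u : L2Pair Ω} (hu : u ∈ K Ω) :
    (fundamentalTone Ω - lam) * ‖u.1‖ ^ 2 - 2 * ‖hf.toLp f‖ * ‖u.1‖ ≤ J f g lam Ω u := by
  rw [J_eq hf hg]
  have h1 := fundamentalTone_mul_le hu.1
  have h2 := real_inner_le_norm (hf.toLp f) u.1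
  have h3 := posEnergy_nonneg (ν := volume.restrict Ω) (g := g) u.1
  nlinarith

theorem exists_norm_le_of_J_le (hf : MemLp f 2 (volume.restrict Ω))
    (hg : MemLp g 2 (volume.restrict Ω)) {lam : ℝ} (hlam : lam < fundamentalTone Ω) (C : ℝ) :
    ∃ R, ∀ u ∈ K Ω, J f g lam Ω u ≤ C → ‖u.1‖ ≤ R := by
  set c := fundamentalTone Ω - lam with hcdef
  have hc : 0 < c := sub_pos.2 hlam
  set b := ‖hf.toLp f‖
  have hb : 0 ≤ b := norm_nonneg _
  -- For `r = ‖u.1‖` beyond this radius, `r > 1` and `c (r - 1) > 2b + |C|`; multiplying by `r`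
  -- gives `c r² - 2 b r > C`.
  refine ⟨1 + (2 * b + |C|) / c, fun u hu hC => ?_⟩
  have h := (coercive hf hg lam hu).trans hC
  rw [← hcdef] at h
  by_contra! hlt
  have h1 : 1 < ‖u.1‖ := lt_of_le_of_lt (by have : 0 ≤ (2 * b + |C|) / c := by positivity
                                            linarith) hlt
  have h2 : (2 * b + |C|) / c < ‖u.1‖ - 1 := by linarith
  rw [div_lt_iff₀ hc] at h2
  have h3 : (2 * b + |C|) * ‖u.1‖ < (‖u.1‖ - 1) * c * ‖u.1‖ :=
    mul_lt_mul_of_pos_right h2 (by linarith)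
  nlinarith [le_abs_self C, abs_nonneg C]

theorem bddBelow_J (hf : MemLp f 2 (volume.restrict Ω)) (hg : MemLp g 2 (volume.restrict Ω))
    {lam : ℝ} (hlam : lam < fundamentalTone Ω) : BddBelow (J f g lam Ω '' K Ω) := by
  have hc : 0 < fundamentalTone Ω - lam := sub_pos.2 hlam
  -- The minimum of the quadratic in `coercive`, found by completing the square.
  refine ⟨-(‖hf.toLp f‖ ^ 2 / (fundamentalTone Ω - lam)), ?_⟩
  rintro _ ⟨u, hu, rfl⟩
  refine le_trans ?_ (coercive hf hg lam hu)
  rw [neg_le_iff_add_nonneg, ← mul_nonneg_iff_of_pos_left hc]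
  have : (fundamentalTone Ω - lam) * ((fundamentalTone Ω - lam) * ‖u.1‖ ^ 2
      - 2 * ‖hf.toLp f‖ * ‖u.1‖ + ‖hf.toLp f‖ ^ 2 / (fundamentalTone Ω - lam))
      = ((fundamentalTone Ω - lam) * ‖u.1‖ - ‖hf.toLp f‖) ^ 2 := by
    field_simp
    ring
  rw [this]
  positivity

/-- A minimizer whose function part has least norm exists. -/
theorem exists_minimizer_norm_le [IsFiniteMeasure (volume.restrict Ω)]
    (hf : MemLp f 2 (volume.restrict Ω))
    (hg : MemLp g 2 (volume.restrict Ω)) {lam : ℝ} (hlam : lam < fundamentalTone Ω) :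
    ∃ u ∈ minimizers f g lam Ω, ∀ v ∈ minimizers f g lam Ω, ‖u.1‖ ≤ ‖v.1‖ := by
  set I := sInf (J f g lam Ω '' K Ω) with hI
  have hIle : ∀ v ∈ K Ω, I ≤ J f g lam Ω v := fun v hv =>
    csInf_le (bddBelow_J hf hg hlam) ⟨v, hv, rfl⟩
  -- Submodularity adds the excesses of two competitors over `I`; halving makes two excesses at
  -- level `k + 1` fit into level `k`.
  let e : ℕ → ℝ := fun k => (1 / 2) ^ k
  have hepos : ∀ k, 0 < e k := fun k => by positivity
  have heanti : Antitone e := pow_right_anti₀ (by norm_num) (by norm_num)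
  have he0 : Tendsto e atTop (𝓝 0) :=
    tendsto_pow_atTop_nhds_zero_of_lt_one (by norm_num) (by norm_num)
  let S : ℕ → Set (Lp ℝ 2 (volume.restrict Ω)) := fun k =>
    {x | ∃ u ∈ K Ω, u.1 = x ∧ J f g lam Ω u ≤ I + e k}
  have hne : ∀ k, (S k).Nonempty := by
    intro k
    obtain ⟨_, ⟨u, hu, rfl⟩, hlt⟩ := exists_lt_of_csInf_lt
      ((nonempty_of_mem zero_mem_K).image (J f g lam Ω))
      (show sInf (J f g lam Ω '' K Ω) < I + e k from lt_add_of_pos_right _ (hepos k))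
    exact ⟨u.1, u, hu, rfl, hlt.le⟩
  have hanti : Antitone S := by
    rintro k j hkj x ⟨u, hu, hux, hJ⟩
    exact ⟨u, hu, hux, hJ.trans (by have := heanti hkj; linarith)⟩
  obtain ⟨R, hR⟩ := exists_norm_le_of_J_le hf hg hlam (I + e 0)
  obtain ⟨x, w, hx, hxw, hmin⟩ := exists_tendsto_of_inf_mem hne hanti
    (by rintro _ ⟨u, hu, rfl, -⟩; exact hu.2)
    (by rintro _ ⟨u, hu, rfl, hJ⟩; exact hR u hu hJ) (by
      rintro k j hkj _ ⟨u, hu, rfl, huJ⟩ _ ⟨v, hv, rfl, hvJ⟩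
      obtain ⟨a, ha, b, hb, ha1, -, hab⟩ := exists_inf_sup_mem_K hf hg lam hu hv
      refine ⟨a, ha, ha1, ?_⟩
      have h1 := hIle b hb
      have h2 : e (j + 1) ≤ e (k + 1) := heanti (by omega)
      have h3 : e k = 2 * e (k + 1) := by simp only [e, pow_succ]; ring
      linarith)
  choose u huK hux huJ using hx
  have hc : Tendsto (fun k => I + e k) atTop (𝓝 I) := by simpa using he0.const_add I
  obtain ⟨G, hG, hGJ⟩ := exists_mem_K_of_tendsto hf hg lam huK
    (hxw.congr fun k => (hux k).symm) hc huJ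
  refine ⟨(w, G), ⟨hG, fun v hv => hGJ.trans (hIle v hv)⟩, fun v hv => ?_⟩
  refine hmin v.1 (mem_iInter.2 fun k => ⟨v, hv.1, rfl, ?_⟩)
  exact ((hv.2 _ hG).trans hGJ).trans (le_add_of_nonneg_right (hepos k).le)

/-- The minimizers form a lattice. -/
theorem exists_inf_sup_mem_minimizers [IsFiniteMeasure (volume.restrict Ω)]
    (hf : MemLp f 2 (volume.restrict Ω))
    (hg : MemLp g 2 (volume.restrict Ω)) {lam : ℝ} {u v : L2Pair Ω}
    (hu : u ∈ minimizers f g lam Ω) (hv : v ∈ minimizers f g lam Ω) :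
    ∃ a ∈ minimizers f g lam Ω, ∃ b ∈ minimizers f g lam Ω,
      a.1 = u.1 ⊓ v.1 ∧ b.1 = u.1 ⊔ v.1 := by
  obtain ⟨a, ha, b, hb, ha1, hb1, hab⟩ := exists_inf_sup_mem_K hf hg lam hu.1 hv.1
  have h1 := hu.2 a ha
  have h2 := hv.2 b hb
  refine ⟨a, ⟨ha, fun z hz => ?_⟩, b, ⟨hb, fun z hz => ?_⟩, ha1, hb1⟩
  · have := hu.2 z hz
    linarith
  · have := hv.2 z hz
    linarith

/-- Minimality at `lam` removes the infimum from the submodular inequality; rewriting at `mu` leaves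
`‖u ⊔ v‖ ≤ ‖v‖`, which forces `u ⊔ v = v`. -/
theorem fst_le_fst_of_lt [IsFiniteMeasure (volume.restrict Ω)]
    (hf : MemLp f 2 (volume.restrict Ω))
    (hg : MemLp g 2 (volume.restrict Ω)) {lam mu : ℝ} (hlt : lam < mu) {u v : L2Pair Ω}
    (hu : u ∈ minimizers f g lam Ω) (hv : v ∈ minimizers f g mu Ω) : u.1 ≤ v.1 := by
  obtain ⟨a, ha, b, hb, -, hb1, hab⟩ := exists_inf_sup_mem_K hf hg lam hu.1 hv.1
  have h1 := hu.2 a ha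
  have h2 := hv.2 b hb
  rw [J_eq_add hf hg lam mu b, J_eq_add hf hg lam mu v] at hab
  have h3 : (mu - lam) * ‖b.1‖ ^ 2 ≤ (mu - lam) * ‖v.1‖ ^ 2 := by linarith
  have h4 : ‖b.1‖ ≤ ‖v.1‖ :=
    le_of_sq_le_sq (le_of_mul_le_mul_left h3 (sub_pos.2 hlt)) (norm_nonneg _)
  have h5 : v.1 ≤ b.1 := hb1 ▸ le_sup_right
  rw [eq_of_le_of_norm_le hv.1.2 h5 h4, hb1]
  exact le_sup_left

/-- A minimizer is determined by its function part. -/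
theorem minimizers_ext (hf : MemLp f 2 (volume.restrict Ω))
    (hg : MemLp g 2 (volume.restrict Ω)) {lam mu : ℝ} {u v : L2Pair Ω}
    (hu : u ∈ minimizers f g lam Ω) (hv : v ∈ minimizers f g mu Ω) (h : u.1 = v.1) : u = v := by
  have key : ∀ {lam : ℝ} {u v : L2Pair Ω}, u ∈ minimizers f g lam Ω → v ∈ K Ω → v.1 = u.1 →
      ‖u.2‖ ^ 2 ≤ ‖v.2‖ ^ 2 := by
    intro lam u v hu hv h
    have := hu.2 v hv
    rw [J_eq hf hg, J_eq hf hg, h] at this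
    linarith
  have h1 := key hu hv.1 h.symm
  have h2 := key hv hu.1 h
  -- The midpoint has the same function part, so it competes through its gradient alone; the
  -- parallelogram law makes the gradients equal.
  have h3 := key hu (convex_K hu.1 hv.1 (a := 1 / 2) (b := 1 / 2) (by norm_num) (by norm_num)
    (by norm_num)) (by simp only [Prod.fst_add, Prod.smul_fst, ← h]; module)
  rw [Prod.snd_add, Prod.smul_snd, Prod.smul_snd, ← smul_add, norm_smul, mul_pow] at h3
  have h4 := parallelogram_law_with_norm ℝ u.2 v.2
  norm_num at h3
  have h5 : ‖u.2 - v.2‖ = 0 := by nlinarith [norm_nonneg (u.2 - v.2)]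
  exact Prod.ext h (sub_eq_zero.1 (norm_eq_zero.1 h5))

/-- The Euler relation obtained by scaling a minimizer. -/
theorem norm_sq_sub_eq_inner (hf : MemLp f 2 (volume.restrict Ω))
    (hg : MemLp g 2 (volume.restrict Ω)) {lam : ℝ} {u : L2Pair Ω}
    (hu : u ∈ minimizers f g lam Ω) :
    ‖u.2‖ ^ 2 - lam * ‖u.1‖ ^ 2 = inner ℝ (hf.toLp f) u.1 := by
  set Q := ‖u.2‖ ^ 2 - lam * ‖u.1‖ ^ 2 with hQ
  set F : ℝ := inner ℝ (hf.toLp f) u.1 with hF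
  -- Scaling by `t > 0` preserves the positivity set, so along the ray the functional is a quadratic
  -- in `t` plus a constant, minimal at `t = 1`.
  have hscale : ∀ t : ℝ, 0 < t → Q - 2 * F ≤ t ^ 2 * Q - 2 * (t * F) := by
    intro t ht
    have := hu.2 (t • u) (smul_mem_K ht.le hu.1)
    rw [J_eq hf hg, J_eq hf hg, Prod.smul_fst, Prod.smul_snd, posEnergy_smul ht, norm_smul,
      norm_smul, inner_smul_right, mul_pow, mul_pow, Real.norm_eq_abs, sq_abs, ← hF] at this
    linear_combination this
  have hderiv : HasDerivAt (fun t : ℝ => t ^ 2 * Q - 2 * (t * F)) (2 * Q - 2 * F) 1 := by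
    exact (((hasDerivAt_pow 2 (1 : ℝ)).mul_const Q).sub
      (((hasDerivAt_id (1 : ℝ)).mul_const F).const_mul 2)).congr_deriv (by norm_num)
  have hmin : IsLocalMin (fun t : ℝ => t ^ 2 * Q - 2 * (t * F)) 1 := by
    filter_upwards [lt_mem_nhds (zero_lt_one (α := ℝ))] with t ht
    simpa using hscale t ht
  have := hmin.hasDerivAt_eq_zero hderiv
  linarith

/-- The gradients agree too, so subtracting the two Euler relations leaves `(mu - lam)‖u‖² = 0`. -/
theorem fst_eq_zero_of_mem_minimizers (hf : MemLp f 2 (volume.restrict Ω))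
    (hg : MemLp g 2 (volume.restrict Ω)) {lam mu : ℝ} (hlt : lam < mu) {u v : L2Pair Ω}
    (hu : u ∈ minimizers f g lam Ω) (hv : v ∈ minimizers f g mu Ω) (h : u.1 = v.1) :
    u.1 = 0 := by
  obtain rfl := minimizers_ext hf hg hu hv h
  have h1 := norm_sq_sub_eq_inner hf hg hu
  have h2 := norm_sq_sub_eq_inner hf hg hv
  have h3 : (mu - lam) * ‖u.1‖ ^ 2 = 0 := by linarith
  have h4 := (mul_eq_zero.1 h3).resolve_left (sub_pos.2 hlt).ne'
  simpa using h4

/-- If `u` has least norm, the minimizer `u ⊓ v` lies below `u` without smaller norm, so it equals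
`u`. -/
theorem exists_least_minimizer [IsFiniteMeasure (volume.restrict Ω)]
    (hf : MemLp f 2 (volume.restrict Ω))
    (hg : MemLp g 2 (volume.restrict Ω)) {lam : ℝ} (hlam : lam < fundamentalTone Ω) :
    ∃ u ∈ minimizers f g lam Ω, ∀ v ∈ minimizers f g lam Ω, u.1 ≤ v.1 := by
  obtain ⟨u, hu, hmin⟩ := exists_minimizer_norm_le hf hg hlam
  refine ⟨u, hu, fun v hv => ?_⟩
  obtain ⟨a, ha, -, -, ha1, -⟩ := exists_inf_sup_mem_minimizers hf hg hu hv
  rw [← eq_of_le_of_norm_le ha.1.2 (ha1 ▸ inf_le_left : a.1 ≤ u.1) (hmin a ha), ha1]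
  exact inf_le_right

/-- Lower semicontinuity closes the set of minimizing functions in `L²`, coercivity bounds it, and
the lattice property gives suprema. -/
theorem exists_greatest_minimizer [IsFiniteMeasure (volume.restrict Ω)]
    (hf : MemLp f 2 (volume.restrict Ω))
    (hg : MemLp g 2 (volume.restrict Ω)) {lam : ℝ} (hlam : lam < fundamentalTone Ω) :
    ∃ u ∈ minimizers f g lam Ω, ∀ v ∈ minimizers f g lam Ω, v.1 ≤ u.1 := by
  obtain ⟨u₀, hu₀, -⟩ := exists_minimizer_norm_le hf hg hlam
  obtain ⟨R, hR⟩ := exists_norm_le_of_J_le hf hg hlam (J f g lam Ω u₀)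
  obtain ⟨_, ⟨w, hw, rfl⟩, hmax⟩ := exists_greatest_of_sup_mem
    (S := Prod.fst '' minimizers f g lam Ω) ⟨_, u₀, hu₀, rfl⟩ (by
      refine IsSeqClosed.isClosed fun x w hx hxw => ?_
      choose u hu hux using hx
      obtain ⟨G, hG, hGJ⟩ := exists_mem_K_of_tendsto hf hg lam (fun k => (hu k).1)
        (hxw.congr fun k => (hux k).symm) tendsto_const_nhds (fun k => (hu k).2 u₀ hu₀.1)
      exact ⟨(w, G), ⟨hG, fun v hv => hGJ.trans (hu₀.2 v hv)⟩, rfl⟩)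
    (by rintro _ ⟨u, hu, rfl⟩; exact hu.1.2)
    (by rintro _ ⟨u, hu, rfl⟩; exact hR u hu.1 (hu.2 u₀ hu₀.1)) (by
      rintro _ ⟨u, hu, rfl⟩ _ ⟨v, hv, rfl⟩
      obtain ⟨-, -, b, hb, -, hb1⟩ := exists_inf_sup_mem_minimizers hf hg hu hv
      exact ⟨b, hb, hb1⟩)
  exact ⟨w, hw, fun v hv => hmax ⟨v, hv, rfl⟩⟩

end Functional

end FreeBdry


/-! ### Monotonicity of the norms and generic uniqueness -/

theorem proposition5 (n : ℕ) (hn : 2 ≤ n) (Ω : Set (FreeBdry.E n))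
    (hΩo : IsOpen Ω) (hΩne : Ω.Nonempty) (hΩb : Bornology.IsBounded Ω)
    (hΩC1 : FreeBdry.HasC1Boundary Ω)
    (f g : FreeBdry.E n → ℝ)
    (hf : MemLp f ∞ (volume.restrict Ω)) (hg : MemLp g ∞ (volume.restrict Ω))
    (hg0 : ∀ᵐ x ∂(volume.restrict Ω), 0 ≤ g x) :
    -- extremal minimizers exist, and `m`, `M` are their norms and an honest minimum and maximum
    (∀ lam < FreeBdry.fundamentalTone Ω,
      (∃ u ∈ FreeBdry.minimizers f g lam Ω,
        (∀ v ∈ FreeBdry.minimizers f g lam Ω, u.1 ≤ v.1) ∧ ‖u.1‖ = FreeBdry.mNorm f g Ω lam) ∧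
      (∃ u ∈ FreeBdry.minimizers f g lam Ω,
        (∀ v ∈ FreeBdry.minimizers f g lam Ω, v.1 ≤ u.1) ∧ ‖u.1‖ = FreeBdry.MNorm f g Ω lam) ∧
      IsLeast (FreeBdry.minimizerNorms f g lam Ω) (FreeBdry.mNorm f g Ω lam) ∧
      IsGreatest (FreeBdry.minimizerNorms f g lam Ω) (FreeBdry.MNorm f g Ω lam)) ∧
    -- monotonicity, strict where the minimizers are not trivial
    MonotoneOn (FreeBdry.mNorm f g Ω) (Iio (FreeBdry.fundamentalTone Ω)) ∧
    MonotoneOn (FreeBdry.MNorm f g Ω) (Iio (FreeBdry.fundamentalTone Ω)) ∧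
    StrictMonoOn (FreeBdry.mNorm f g Ω) (FreeBdry.nontrivialParams f g Ω) ∧
    StrictMonoOn (FreeBdry.MNorm f g Ω) (FreeBdry.nontrivialParams f g Ω) ∧
    (∀ lam < FreeBdry.fundamentalTone Ω, ∀ ε > 0,
      FreeBdry.MNorm f g Ω (lam - ε) ≤ FreeBdry.mNorm f g Ω lam ∧
      (lam - ε ∈ FreeBdry.nontrivialParams f g Ω →
        FreeBdry.MNorm f g Ω (lam - ε) < FreeBdry.mNorm f g Ω lam)) ∧
    -- uniqueness outside a countable set
    (∃ Z ⊆ Iio (FreeBdry.fundamentalTone Ω), Z.Countable ∧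
      ∀ lam ∈ Iio (FreeBdry.fundamentalTone Ω) \ Z,
        ∃! u, u ∈ FreeBdry.minimizers f g lam Ω) := by
  open FreeBdry in
  have : IsFiniteMeasure (volume.restrict Ω) :=
    isFiniteMeasure_restrict.2 hΩb.measure_lt_top.ne
  have hf2 : MemLp f 2 (volume.restrict Ω) := hf.mono_exponent le_top
  have hg2 : MemLp g 2 (volume.restrict Ω) := hg.mono_exponent le_top
  have hleast : ∀ lam < fundamentalTone Ω, ∃ u ∈ minimizers f g lam Ω,
      (∀ v ∈ minimizers f g lam Ω, u.1 ≤ v.1) ∧ ‖u.1‖ = mNorm f g Ω lam ∧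
      IsLeast (minimizerNorms f g lam Ω) (mNorm f g Ω lam) := by
    intro lam hlam
    obtain ⟨u, hu, hmin⟩ := exists_least_minimizer hf2 hg2 hlam
    have hl : IsLeast (minimizerNorms f g lam Ω) ‖u.1‖ := by
      refine ⟨⟨u, hu, rfl⟩, ?_⟩
      rintro _ ⟨v, hv, rfl⟩
      exact norm_le_norm_of_nonneg_of_le hu.1.2 (hmin v hv)
    have he : ‖u.1‖ = mNorm f g Ω lam := hl.csInf_eq.symm
    exact ⟨u, hu, hmin, he, he ▸ hl⟩
  have hgreatest : ∀ lam < fundamentalTone Ω, ∃ u ∈ minimizers f g lam Ω,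
      (∀ v ∈ minimizers f g lam Ω, v.1 ≤ u.1) ∧ ‖u.1‖ = MNorm f g Ω lam ∧
      IsGreatest (minimizerNorms f g lam Ω) (MNorm f g Ω lam) := by
    intro lam hlam
    obtain ⟨u, hu, hmax⟩ := exists_greatest_minimizer hf2 hg2 hlam
    have hl : IsGreatest (minimizerNorms f g lam Ω) ‖u.1‖ := by
      refine ⟨⟨u, hu, rfl⟩, ?_⟩
      rintro _ ⟨v, hv, rfl⟩
      exact norm_le_norm_of_nonneg_of_le hv.1.2 (hmax v hv)
    have he : ‖u.1‖ = MNorm f g Ω lam := hl.csSup_eq.symm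
    exact ⟨u, hu, hmax, he, he ▸ hl⟩
  have hmM : ∀ lam < fundamentalTone Ω, mNorm f g Ω lam ≤ MNorm f g Ω lam := by
    intro lam hlam
    obtain ⟨-, -, -, -, hl⟩ := hleast lam hlam
    obtain ⟨-, -, -, -, hG⟩ := hgreatest lam hlam
    exact hl.2 hG.1
  -- Chained with `m ≤ M` at a single parameter, this comparison gives both monotonicity claims.
  have hMm : ∀ lam mu, lam < mu → mu < fundamentalTone Ω →
      MNorm f g Ω lam ≤ mNorm f g Ω mu := by
    intro lam mu hlt hmu
    obtain ⟨u, hu, -, hun, -⟩ := hgreatest lam (hlt.trans hmu)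
    obtain ⟨v, hv, -, hvn, -⟩ := hleast mu hmu
    rw [← hun, ← hvn]
    exact norm_le_norm_of_nonneg_of_le hu.1.2 (fst_le_fst_of_lt hf2 hg2 hlt hu hv)
  have hMm' : ∀ lam mu, lam < mu → mu < fundamentalTone Ω → lam ∈ nontrivialParams f g Ω →
      MNorm f g Ω lam < mNorm f g Ω mu := by
    intro lam mu hlt hmu ⟨hlam, z, hz, hz0⟩
    refine lt_of_le_of_ne (hMm lam mu hlt hmu) fun heq => ?_
    obtain ⟨u, hu, humax, hun, -⟩ := hgreatest lam hlam
    obtain ⟨v, hv, -, hvn, -⟩ := hleast mu hmu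
    -- Equal norms identify the largest minimizer for `lam` with the smallest for `mu`; it then
    -- vanishes, and so does every minimizer for `lam`.
    have huv : u.1 = v.1 := eq_of_le_of_norm_le hu.1.2 (fst_le_fst_of_lt hf2 hg2 hlt hu hv)
      (by rw [hun, hvn, heq])
    have hu0 := fst_eq_zero_of_mem_minimizers hf2 hg2 hlt hu hv huv
    exact hz0 (le_antisymm (hu0 ▸ humax z hz) hz.1.2)
  refine ⟨fun lam hlam => ?_, ?_, ?_, ?_, ?_, fun lam hlam ε hε => ⟨?_, ?_⟩, ?_⟩
  · obtain ⟨u, hu, humin, hun, hl⟩ := hleast lam hlam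
    obtain ⟨v, hv, hvmax, hvn, hG⟩ := hgreatest lam hlam
    exact ⟨⟨u, hu, humin, hun⟩, ⟨v, hv, hvmax, hvn⟩, hl, hG⟩
  · intro lam hlam mu hmu hle
    rcases hle.eq_or_lt with rfl | hlt
    · exact le_rfl
    · exact (hmM lam hlam).trans (hMm lam mu hlt hmu)
  · intro lam hlam mu hmu hle
    rcases hle.eq_or_lt with rfl | hlt
    · exact le_rfl
    · exact (hMm lam mu hlt hmu).trans (hmM mu hmu)
  · intro lam hlam mu hmu hlt
    exact (hmM lam hlam.1).trans_lt (hMm' lam mu hlt hmu.1 hlam)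
  · intro lam hlam mu hmu hlt
    exact (hMm' lam mu hlt hmu.1 hlam).trans_le (hmM mu hmu.1)
  · exact hMm _ _ (sub_lt_self lam hε) hlam
  · exact hMm' _ _ (sub_lt_self lam hε) hlam
  -- Where `m = M`, the smallest and largest minimizers coincide, so `Z` consists of the parameters
  -- with a gap.
  · refine ⟨{lam | lam < fundamentalTone Ω ∧ mNorm f g Ω lam < MNorm f g Ω lam},
      fun lam h => h.1, ?_, ?_⟩
    · -- each exceptional parameter contains a rational number in its gap of norms
      have hq : ∀ lam : {lam | lam < fundamentalTone Ω ∧ mNorm f g Ω lam < MNorm f g Ω lam},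
          ∃ q : ℚ, mNorm f g Ω lam < q ∧ (q : ℝ) < MNorm f g Ω lam :=
        fun lam => exists_rat_btwn lam.2.2
      choose q hq1 hq2 using hq
      have hinj : Function.Injective q := by
        intro a b hab
        by_contra hne
        have ha := hq1 a
        have ha' := hq2 a
        have hb := hq1 b
        have hb' := hq2 b
        rw [hab] at ha ha'
        rcases lt_or_gt_of_ne (Subtype.coe_ne_coe.2 hne) with h | h
        · have := hMm a b h b.2.1
          linarith
        · have := hMm b a h a.2.1
          linarith
      exact countable_coe_iff.1 hinj.countable
    · rintro lam ⟨hlam, hZ⟩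
      obtain ⟨u, hu, humin, hun, -⟩ := hleast lam hlam
      obtain ⟨v, hv, hvmax, hvn, -⟩ := hgreatest lam hlam
      have hle : MNorm f g Ω lam ≤ mNorm f g Ω lam := not_lt.1 fun h => hZ ⟨hlam, h⟩
      have huv : u.1 = v.1 := eq_of_le_of_norm_le hu.1.2 (humin v hv) (by rw [hun, hvn]; exact hle)
      refine ⟨u, hu, fun z hz => minimizers_ext hf2 hg2 hz hu ?_⟩
      exact le_antisymm (huv ▸ hvmax z hz) (humin z hz)
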